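/- **Lemma 4.2.** Let $\mathbb K$ be a field, $n\ge 1$ an integer, $Q=(q_1,\dots,q_n)\in(\mathbb K^*)^n$, and $\Gamma=(\gamma_{ij})$ a multiplicatively skew-symmetric $n\times n$ matrix over $\mathbb K^*$ (that is, $\gamma_{ii}=1$ and $\gamma_{ij}\gamma_{ji}=1$ for all $i,j$). Let $A=A_n^{Q,\Gamma}(\mathbb K)$ be the multiparameter quantized Weyl algebra, i.e. the unital associative $\mathbb K$-algebra with generators $x_1,y_1,\dots,x_n,y_n$ and defining relations $$\begin{aligned} y_iy_j&=\gamma_{ij}y_jy_i && (\text{all } i,j),\\ x_ix_j&=q_i\gamma_{ij}x_jx_i && (i<j),\\ x_iy_j&=\gamma_{ji}y_jx_i && (i<j),\\ x_iy_j&=q_j\gamma_{ji}y_jx_i && (i>j),\\ x_jy_j-q_jy_jx_j&=1+\sum_{k=1}^{j-1}(q_k-1)y_kx_k && (\text{all } j), \end{aligned}$$ and put $z_i=[x_i,y_i]=x_iy_i-y_ix_i=1+\sum_{k=1}^{i}(q_k-1)y_kx_k$ for $1\le i\le n$. Assume that none of $q_1,\dots,q_n$ is a root of unity. Give $A$ the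 $\mathbb N$-filtration by total degree in which $x_n,y_n$ have degree $1$ and $x_i,y_i$ have degree $0$ for $i<n$: the $k$-th piece $F_k$ is the $\mathbb K$-span of all products of generators whose degrees sum to at most $k$, and $d(a)=\min\{k : a\in F_k\}$. If $a,b\in A\setminus\mathbb K$ satisfy $d(ab)=2$ and $ab\in\operatorname{Span}_{\mathbb K}\{z_1,\dots,z_n\}$, then there are $\mu,\nu\in\mathbb K^*$ such that either $(a,b)=(\mu x_n,\nu y_n)$ or $(a,b)=(\mu y_n,\nu x_n)$. -/

import Mathlib

namespace MQWA

/-- A matrix of nonzero scalars is multiplicatively skew-symmetric if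
`γ i i = 1` and `γ i j * γ j i = 1` for all `i`, `j`. -/
def IsMulSkewSymm {K : Type*} [Field K] {n : ℕ} (Γ : Matrix (Fin n) (Fin n) Kˣ) : Prop :=
  (∀ i, Γ i i = 1) ∧ ∀ i j, Γ i j * Γ j i = 1

/-- The symbols `x_i`, `y_i`; the index `i : Fin n` stands for the `i + 1`-st generator. -/
inductive Gen (n : ℕ) : Type
  | x (i : Fin n) : Gen n
  | y (i : Fin n) : Gen n

/-- The symbol `x_i` in the free algebra. -/
abbrev fx (K : Type*) [Field K] {n : ℕ} (i : Fin n) : FreeAlgebra K (Gen n) :=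
  FreeAlgebra.ι K (Gen.x i)

/-- The symbol `y_i` in the free algebra. -/
abbrev fy (K : Type*) [Field K] {n : ℕ} (i : Fin n) : FreeAlgebra K (Gen n) :=
  FreeAlgebra.ι K (Gen.y i)

/-- The defining relations of the multiparameter quantized Weyl algebra. -/
inductive Rel {K : Type*} [Field K] {n : ℕ} (Q : Fin n → Kˣ) (Γ : Matrix (Fin n) (Fin n) Kˣ) :
    FreeAlgebra K (Gen n) → FreeAlgebra K (Gen n) → Prop
  | yy (i j : Fin n) :
      Rel Q Γ (fy K i * fy K j) ((Γ i j : K) • (fy K j * fy K i))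
  | xx (i j : Fin n) (h : i < j) :
      Rel Q Γ (fx K i * fx K j) (((Q i : K) * (Γ i j : K)) • (fx K j * fx K i))
  | xy_lt (i j : Fin n) (h : i < j) :
      Rel Q Γ (fx K i * fy K j) ((Γ j i : K) • (fy K j * fx K i))
  | xy_gt (i j : Fin n) (h : j < i) :
      Rel Q Γ (fx K i * fy K j) (((Q j : K) * (Γ j i : K)) • (fy K j * fx K i))
  | xy_eq (j : Fin n) :
      Rel Q Γ (fx K j * fy K j - (Q j : K) • (fy K j * fx K j))
        (1 + ∑ k ∈ Finset.Iio j, ((Q k : K) - 1) • (fy K k * fx K k))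

/-- The multiparameter quantized Weyl algebra: the unital associative `K`-algebra generated by
`x_1, y_1, …, x_n, y_n` subject to the relations `Rel Q Γ`. -/
def QWeyl {K : Type*} [Field K] {n : ℕ} (Q : Fin n → Kˣ)
    (Γ : Matrix (Fin n) (Fin n) Kˣ) : Type _ :=
  RingQuot (Rel Q Γ)

noncomputable instance instRingQWeyl {K : Type*} [Field K] {n : ℕ} (Q : Fin n → Kˣ)
    (Γ : Matrix (Fin n) (Fin n) Kˣ) : Ring (QWeyl Q Γ) :=
  inferInstanceAs (Ring (RingQuot (Rel Q Γ)))

noncomputable instance instAlgebraQWeyl {K : Type*} [Field K] {n : ℕ} (Q : Fin n → Kˣ)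
    (Γ : Matrix (Fin n) (Fin n) Kˣ) : Algebra K (QWeyl Q Γ) :=
  inferInstanceAs (Algebra K (RingQuot (Rel Q Γ)))

/-- The quotient map from the free algebra. -/
noncomputable def mk {K : Type*} [Field K] {n : ℕ} (Q : Fin n → Kˣ)
    (Γ : Matrix (Fin n) (Fin n) Kˣ) : FreeAlgebra K (Gen n) →ₐ[K] QWeyl Q Γ :=
  RingQuot.mkAlgHom K (Rel Q Γ)

/-- The image of a generator symbol in the algebra. -/
noncomputable def gen {K : Type*} [Field K] {n : ℕ} (Q : Fin n → Kˣ)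
    (Γ : Matrix (Fin n) (Fin n) Kˣ) (g : Gen n) : QWeyl Q Γ :=
  mk Q Γ (FreeAlgebra.ι K g)

/-- The generator `x_i`. -/
noncomputable def x {K : Type*} [Field K] {n : ℕ} (Q : Fin n → Kˣ)
    (Γ : Matrix (Fin n) (Fin n) Kˣ) (i : Fin n) : QWeyl Q Γ :=
  gen Q Γ (Gen.x i)

/-- The generator `y_i`. -/
noncomputable def y {K : Type*} [Field K] {n : ℕ} (Q : Fin n → Kˣ)
    (Γ : Matrix (Fin n) (Fin n) Kˣ) (i : Fin n) : QWeyl Q Γ :=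
  gen Q Γ (Gen.y i)

/-- The element `z_i = [x_i, y_i]`. -/
noncomputable def z {K : Type*} [Field K] {n : ℕ} (Q : Fin n → Kˣ)
    (Γ : Matrix (Fin n) (Fin n) Kˣ) (i : Fin n) : QWeyl Q Γ :=
  x Q Γ i * y Q Γ i - y Q Γ i * x Q Γ i

/-- `z_i = 1 + ∑_{k ≤ i} (q_k - 1) y_k x_k`. -/
theorem z_eq {K : Type*} [Field K] {n : ℕ} (Q : Fin n → Kˣ)
    (Γ : Matrix (Fin n) (Fin n) Kˣ) (i : Fin n) :
    z Q Γ i = 1 + ∑ k ∈ Finset.Iic i, ((Q k : K) - 1) • (y Q Γ k * x Q Γ k) := by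
  have h : mk Q Γ _ = mk Q Γ _ := RingQuot.mkAlgHom_rel K (Rel.xy_eq (Q := Q) (Γ := Γ) i)
  simp only [map_sub, map_add, map_mul, map_smul, map_one, map_sum] at h
  change x Q Γ i * y Q Γ i - (Q i : K) • (y Q Γ i * x Q Γ i)
    = 1 + ∑ k ∈ Finset.Iio i, ((Q k : K) - 1) • (y Q Γ k * x Q Γ k) at h
  rw [← Finset.Iio_insert i, Finset.sum_insert (by simp), add_left_comm, ← h, z, sub_smul,
    one_smul]
  abel

/-- The degree assigned to a generator: `1` for `x_n` and `y_n`, and `0` for the others. -/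
def Gen.wt {n : ℕ} : Gen n → ℕ
  | Gen.x i => if (i : ℕ) + 1 = n then 1 else 0
  | Gen.y i => if (i : ℕ) + 1 = n then 1 else 0

/-- The `ℕ`-filtration by total degree: the `k`-th piece is spanned over `K` by the products of
generators whose degrees sum to at most `k`. -/
noncomputable def filtration {K : Type*} [Field K] {n : ℕ} (Q : Fin n → Kˣ)
    (Γ : Matrix (Fin n) (Fin n) Kˣ) (k : ℕ) : Submodule K (QWeyl Q Γ) :=
  Submodule.span K
    {a | ∃ w : List (Gen n), (w.map Gen.wt).sum ≤ k ∧ a = (w.map (gen Q Γ)).prod}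

/-- The degree `d(a)`: the least `k` such that `a` lies in the `k`-th piece of the filtration
(so `d(0) = 0` by convention). -/
noncomputable def degree {K : Type*} [Field K] {n : ℕ} (Q : Fin n → Kˣ)
    (Γ : Matrix (Fin n) (Fin n) Kˣ) (a : QWeyl Q Γ) : ℕ :=
  sInf {k | a ∈ filtration Q Γ k}

end MQWA

open scoped MonomialOrder

/-! The normally ordered monomials (all `y`'s before all `x`'s) form a basis of the algebra. They
span because any two generators commute up to a nonzero scalar and lower terms. They are independent
because the algebra acts on polynomials in the `y_j` by raising operators and q-difference
operators, and when no `q_i` is a root of unity the quantum integers that occur do not vanish. For a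
lexicographic order in which generators of larger index dominate, the correction terms `1` and `y_k
x_k` (`k < j`) in the relation for `x_j y_j` are lower, so leading exponents add under
multiplication (`HasLead.mul`).

The product `ab` is a combination of `1` and the `y_k x_k`. Since its degree is not zero, `y_n x_n`
occurs and is its leading monomial. As `a` and `b` are not scalars, their leading monomials are
`y_n` and `x_n` in one of the two possible arrangements. This holds both for the order with `y_n`
first and for the order with `x_n` first, and the arrangements agree. Together the two orders show
that each factor is a multiple of `x_n` or `y_n` plus a remainder free of both letters. Every
monomial of `ab` has equal exponents in `x_n` and `y_n`, which forces both remainders to vanish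
(`eq_smul_of_hasLead`). -/

namespace MQWA

/-! ### Words and their commutative exponent vectors. -/

section Words

variable {σ : Type*}

/-- The exponent vector of a word. -/
noncomputable def expo (w : List σ) : σ →₀ ℕ := (w.map fun s => Finsupp.single s 1).sum

@[simp] theorem expo_nil : expo ([] : List σ) = 0 := rfl

@[simp] theorem expo_cons (s : σ) (w : List σ) :
    expo (s :: w) = Finsupp.single s 1 + expo w := by
  simp [expo]

@[simp] theorem expo_append (v w : List σ) : expo (v ++ w) = expo v + expo w := by
  simp [expo]

theorem expo_perm {v w : List σ} (h : v.Perm w) : expo v = expo w :=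
  (h.map _).sum_eq

open Classical in
theorem expo_apply (w : List σ) (s : σ) : expo w s = w.count s := by
  induction w with
  | nil => simp
  | cons t w ih => simp [ih, List.count_cons, Finsupp.single_apply, add_comm]

open Classical in
theorem perm_of_expo_eq {v w : List σ} (h : expo v = expo w) : v.Perm w := by
  rw [List.perm_iff_count]
  intro s
  rw [← expo_apply, ← expo_apply, h]

end Words

/-! ### Reordering words modulo lower terms. -/

section Low

variable {K A σ : Type*} [Field K] [Ring A] [Algebra K A]

/-- The span of the words in the generators `g` whose exponent is smaller than `e`. -/
def low (K : Type*) {A σ : Type*} [Field K] [Ring A] [Algebra K A] (g : σ → A)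
    (m : MonomialOrder σ) (e : σ →₀ ℕ) : Submodule K A :=
  Submodule.span K {a | ∃ w : List σ, (expo w ≺[m] e) ∧ a = (w.map g).prod}

variable {g : σ → A} {m : MonomialOrder σ}

theorem prod_mem_low {w : List σ} {e : σ →₀ ℕ} (h : expo w ≺[m] e) :
    (w.map g).prod ∈ low K g m e :=
  Submodule.subset_span ⟨w, h, rfl⟩

theorem low_mono {e f : σ →₀ ℕ} (h : e ≼[m] f) : low K g m e ≤ low K g m f := by
  refine Submodule.span_mono ?_
  rintro _ ⟨w, hw, rfl⟩
  exact ⟨w, hw.trans_le h, rfl⟩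

theorem prod_mul_mem_low (w : List σ) {a : A} {e : σ →₀ ℕ} (ha : a ∈ low K g m e) :
    (w.map g).prod * a ∈ low K g m (expo w + e) := by
  refine Submodule.span_induction (p := fun a _ => (w.map g).prod * a ∈ low K g m (expo w + e))
    ?_ (by simp) ?_ ?_ ha
  · rintro _ ⟨v, hv, rfl⟩
    rw [← List.prod_append, ← List.map_append]
    exact prod_mem_low (by simpa using hv)
  · intro a b _ _ h₁ h₂
    rw [mul_add]
    exact add_mem h₁ h₂
  · intro c a _ h
    rw [mul_smul_comm]
    exact Submodule.smul_mem _ _ h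

theorem mul_prod_mem_low (w : List σ) {a : A} {e : σ →₀ ℕ} (ha : a ∈ low K g m e) :
    a * (w.map g).prod ∈ low K g m (e + expo w) := by
  refine Submodule.span_induction (p := fun a _ => a * (w.map g).prod ∈ low K g m (e + expo w))
    ?_ (by simp) ?_ ?_ ha
  · rintro _ ⟨v, hv, rfl⟩
    rw [← List.prod_append, ← List.map_append]
    exact prod_mem_low (by simpa using hv)
  · intro a b _ _ h₁ h₂
    rw [add_mul]
    exact add_mem h₁ h₂
  · intro c a _ h
    rw [smul_mul_assoc]
    exact Submodule.smul_mem _ _ h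

theorem mul_mem_low {a b : A} {e f : σ →₀ ℕ} (ha : a ∈ low K g m e) (hb : b ∈ low K g m f) :
    a * b ∈ low K g m (e + f) := by
  refine Submodule.span_induction (p := fun a _ => a * b ∈ low K g m (e + f))
    ?_ (by simp) ?_ ?_ ha
  · rintro _ ⟨v, hv, rfl⟩
    refine low_mono ?_ (prod_mul_mem_low v hb)
    simpa using hv.le
  · intro a b _ _ h₁ h₂
    rw [add_mul]
    exact add_mem h₁ h₂
  · intro c a _ h
    rw [smul_mul_assoc]
    exact Submodule.smul_mem _ _ h

/-- The generators commute up to nonzero scalars and words of smaller exponent. -/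
def SkewCommute (K : Type*) {A σ : Type*} [Field K] [Ring A] [Algebra K A] (g : σ → A)
    (m : MonomialOrder σ) (s t : σ) : Prop :=
  ∃ c : K, c ≠ 0 ∧
    g s * g t - c • (g t * g s) ∈ low K g m (Finsupp.single s 1 + Finsupp.single t 1)

theorem SkewCommute.symm {s t : σ} (h : SkewCommute K g m s t) : SkewCommute K g m t s := by
  obtain ⟨c, hc, h⟩ := h
  refine ⟨c⁻¹, inv_ne_zero hc, ?_⟩
  rw [add_comm]
  convert Submodule.smul_mem _ (-c⁻¹) h using 1
  rw [smul_sub, smul_smul, neg_mul, inv_mul_cancel₀ hc]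
  module

/-- A permutation is a chain of adjacent swaps, and each swap costs a nonzero scalar and an error of
smaller exponent. -/
theorem exists_smul_sub_mem_low_of_perm (hg : ∀ s t, SkewCommute K g m s t) {v w : List σ}
    (h : v.Perm w) :
    ∃ c : K, c ≠ 0 ∧ (v.map g).prod - c • (w.map g).prod ∈ low K g m (expo v) := by
  induction h with
  | nil => exact ⟨1, one_ne_zero, by simp⟩
  | @cons s v w _ ih =>
    obtain ⟨c, hc, h⟩ := ih
    refine ⟨c, hc, ?_⟩
    have := prod_mul_mem_low [s] h
    simpa [mul_sub] using this
  | swap s t w =>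
    obtain ⟨c, hc, h⟩ := hg t s
    refine ⟨c, hc, ?_⟩
    have := mul_prod_mem_low w h
    simpa [sub_mul, mul_assoc, add_assoc] using this
  | @trans u v w huv _ ih₁ ih₂ =>
    obtain ⟨c, hc, h₁⟩ := ih₁
    obtain ⟨d, hd, h₂⟩ := ih₂
    refine ⟨c * d, mul_ne_zero hc hd, ?_⟩
    rw [← expo_perm huv] at h₂
    convert add_mem h₁ (Submodule.smul_mem _ c h₂) using 1
    module

/-- Well-founded induction on the exponent: sorting a word into its chosen representative leaves an
error supported strictly below that word, where the induction hypothesis applies. -/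
theorem low_le_span (hg : ∀ s t, SkewCommute K g m s t) {word : (σ →₀ ℕ) → List σ}
    (hword : ∀ e, expo (word e) = e) (e : σ →₀ ℕ) :
    low K g m e ≤ Submodule.span K ((fun f => ((word f).map g).prod) '' {f | f ≺[m] e}) := by
  induction e using WellFounded.induction (InvImage.wf m.toSyn wellFounded_lt) with
  | _ e ih =>
  refine Submodule.span_le.2 ?_
  rintro _ ⟨w, hw, rfl⟩
  obtain ⟨c, -, h⟩ := exists_smul_sub_mem_low_of_perm (K := K) hg
    (perm_of_expo_eq (hword (expo w)).symm)
  have h₁ := Submodule.span_mono (Set.image_mono fun f (hf : f ≺[m] expo w) => hf.trans hw)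
    (ih _ hw h)
  rw [SetLike.mem_coe, ← sub_add_cancel (w.map g).prod (c • ((word (expo w)).map g).prod)]
  exact add_mem h₁ (Submodule.smul_mem _ _ (Submodule.subset_span ⟨_, hw, rfl⟩))

theorem span_words_le (hg : ∀ s t, SkewCommute K g m s t) {word : (σ →₀ ℕ) → List σ}
    (hword : ∀ e, expo (word e) = e) :
    Submodule.span K (Set.range fun w : List σ => (w.map g).prod) ≤
      Submodule.span K (Set.range fun f => ((word f).map g).prod) := by
  refine Submodule.span_le.2 ?_
  rintro _ ⟨w, rfl⟩
  obtain ⟨c, -, h⟩ := exists_smul_sub_mem_low_of_perm (K := K) hg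
    (perm_of_expo_eq (hword (expo w)).symm)
  have h₁ := Submodule.span_mono (Set.image_subset_range _ _) (low_le_span hg hword _ h)
  dsimp only
  rw [SetLike.mem_coe, ← sub_add_cancel (w.map g).prod (c • ((word (expo w)).map g).prod)]
  exact add_mem h₁ (Submodule.smul_mem _ _ (Submodule.subset_span ⟨_, rfl⟩))

end Low

/-! ### Leading exponents with respect to a monomial basis. -/

section Lead

variable {K A σ : Type*} [Field K] [Ring A] [Algebra K A]

/-- `e` is the leading exponent of `a` with respect to the basis `B`. -/
def HasLead (m : MonomialOrder σ) (B : Module.Basis (σ →₀ ℕ) K A) (a : A) (e : σ →₀ ℕ) : Prop :=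
  B.repr a e ≠ 0 ∧ ∀ f, B.repr a f ≠ 0 → f ≼[m] e

variable {g : σ → A} {m : MonomialOrder σ} {B : Module.Basis (σ →₀ ℕ) K A}
  {word : (σ →₀ ℕ) → List σ}

theorem exists_hasLead (m : MonomialOrder σ) (B : Module.Basis (σ →₀ ℕ) K A) {a : A}
    (ha : a ≠ 0) : ∃ e, HasLead m B a e := by
  have : (B.repr a).support.Nonempty := by simpa using ha
  obtain ⟨e, he, h⟩ := (B.repr a).support.exists_max_image m.toSyn this
  exact ⟨e, by simpa using he, fun f hf => h f (by simpa using hf)⟩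

theorem HasLead.unique {a : A} {e f : σ →₀ ℕ} (he : HasLead m B a e) (hf : HasLead m B a f) :
    e = f :=
  m.toSyn.injective (le_antisymm (hf.2 _ he.1) (he.2 _ hf.1))

theorem HasLead.ne_zero {a : A} {e : σ →₀ ℕ} (h : HasLead m B a e) : a ≠ 0 := by
  rintro rfl
  exact h.1 (by simp)

theorem mem_low_iff (hg : ∀ s t, SkewCommute K g m s t) (hword : ∀ e, expo (word e) = e)
    (hB : ∀ e, B e = ((word e).map g).prod) {a : A} {e : σ →₀ ℕ} :
    a ∈ low K g m e ↔ ∀ f, B.repr a f ≠ 0 → f ≺[m] e := by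
  have h : low K g m e = Submodule.span K (B '' {f | f ≺[m] e}) := by
    have hB' : ⇑B = fun e => ((word e).map g).prod := funext hB
    rw [hB']
    refine le_antisymm (low_le_span hg hword e) (Submodule.span_le.2 ?_)
    rintro _ ⟨f, hf, rfl⟩
    exact prod_mem_low (by rwa [hword])
  rw [h, Module.Basis.mem_span_image]
  simp [Set.subset_def]

/-- Turns a condition on coordinates into a congruence modulo `low`, which is compatible with
products. -/
theorem hasLead_iff (hg : ∀ s t, SkewCommute K g m s t) (hword : ∀ e, expo (word e) = e)
    (hB : ∀ e, B e = ((word e).map g).prod) {a : A} {e : σ →₀ ℕ} :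
    HasLead m B a e ↔ ∃ c : K, c ≠ 0 ∧ a - c • B e ∈ low K g m e := by
  classical
  constructor
  · intro h
    refine ⟨B.repr a e, h.1, (mem_low_iff hg hword hB).2 fun f hf => ?_⟩
    by_cases hfe : f = e
    · subst hfe
      simp at hf
    · refine lt_of_le_of_ne (h.2 f ?_) fun h' => hfe (m.toSyn.injective h')
      simpa [Finsupp.single_apply, Ne.symm hfe] using hf
  · rintro ⟨c, hc, h⟩
    rw [mem_low_iff hg hword hB] at h
    constructor
    · intro h0
      refine lt_irrefl _ (h e ?_)
      simpa [h0] using hc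
    · intro f hf
      by_cases hfe : f = e
      · rw [hfe]
      · refine (h f ?_).le
        simpa [Finsupp.single_apply, Ne.symm hfe] using hf

theorem HasLead.mul (hg : ∀ s t, SkewCommute K g m s t) (hword : ∀ e, expo (word e) = e)
    (hB : ∀ e, B e = ((word e).map g).prod) {a b : A} {e f : σ →₀ ℕ}
    (ha : HasLead m B a e) (hb : HasLead m B b f) : HasLead m B (a * b) (e + f) := by
  rw [hasLead_iff hg hword hB] at ha hb ⊢
  obtain ⟨c, hc, ha⟩ := ha
  obtain ⟨d, hd, hb⟩ := hb
  obtain ⟨k, hk, h⟩ := exists_smul_sub_mem_low_of_perm (K := K) hg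
    (perm_of_expo_eq (show expo (word e ++ word f) = expo (word (e + f)) by simp [hword]))
  rw [expo_append, hword, hword, List.map_append, List.prod_append, ← hB, ← hB, ← hB] at h
  refine ⟨c * d * k, mul_ne_zero (mul_ne_zero hc hd) hk, ?_⟩
  have h₁ := mul_prod_mem_low (word f) ha
  have h₂ := prod_mul_mem_low (word e) hb
  rw [← hB, hword] at h₁ h₂
  have h₃ := mul_mem_low ha hb
  -- With `a = c • B e + a'` and `b = d • B f + b'`, these are the terms `a' B f`, `B e b'`, `a' b'`
  -- and the error from reordering `B e * B f`.
  convert add_mem (add_mem (add_mem (Submodule.smul_mem _ d h₁) (Submodule.smul_mem _ c h₂)) h₃)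
    (Submodule.smul_mem _ (c * d) h) using 1
  simp only [sub_mul, mul_sub, smul_mul_assoc, mul_smul_comm]
  module

theorem HasLead.smul {a : A} {e : σ →₀ ℕ} (ha : HasLead m B a e) {c : K} (hc : c ≠ 0) :
    HasLead m B (c • a) e := by
  refine ⟨by simpa [hc] using ha.1, fun f hf => ha.2 f ?_⟩
  simpa [hc] using hf

theorem HasLead.add {a b : A} {e f : σ →₀ ℕ} (ha : HasLead m B a e) (hb : HasLead m B b f)
    (h : f ≺[m] e) : HasLead m B (a + b) e := by
  have hbe : B.repr b e = 0 := by
    by_contra h'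
    exact (hb.2 e h').not_gt h
  refine ⟨by simpa [hbe] using ha.1, fun i hi => ?_⟩
  by_cases hai : B.repr a i = 0
  · refine (hb.2 i ?_).trans h.le
    simpa [hai] using hi
  · exact ha.2 i hai

theorem hasLead_basis (m : MonomialOrder σ) (B : Module.Basis (σ →₀ ℕ) K A) (e : σ →₀ ℕ) :
    HasLead m B (B e) e := by
  classical
  refine ⟨by simp, fun f hf => ?_⟩
  have : e = f := by
    by_contra h
    simp [h] at hf
  rw [this]

end Lead

/-! ### Factoring an element with leading exponent `p + q`. -/

section Factor

variable {K A σ : Type*} [Field K] [Ring A] [Algebra K A]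

/-- The order compares the exponent of `p` first and the exponent of `q` next. -/
def IsTop (m : MonomialOrder σ) (p q : σ) : Prop :=
  (∀ e f : σ →₀ ℕ, e p < f p → e ≺[m] f) ∧
    ∀ e f : σ →₀ ℕ, e p = f p → e q < f q → e ≺[m] f

theorem eq_single_of_le {m : MonomialOrder σ} {e : σ →₀ ℕ} {s : σ}
    (h : e ≼[m] Finsupp.single s 1) (hs : e s ≠ 0) : e = Finsupp.single s 1 := by
  refine m.toSyn.injective (le_antisymm h (m.toSyn_monotone ?_))
  rw [Finsupp.single_le_iff]
  omega

/-- A monomial containing `p` exceeds `q`, and one containing `q` is at least `q`; so only `q`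
itself and monomials free of both letters lie at or below it. -/
theorem IsTop.of_le_snd {m : MonomialOrder σ} {p q : σ} (hm : IsTop m p q) (hpq : p ≠ q)
    {e : σ →₀ ℕ} (h : e ≼[m] Finsupp.single q 1) :
    e = Finsupp.single q 1 ∨ (e p = 0 ∧ e q = 0) := by
  classical
  by_cases hq : e q = 0
  · refine Or.inr ⟨?_, hq⟩
    by_contra hp
    refine h.not_gt (hm.1 _ _ ?_)
    simp [hpq.symm]
    omega
  · exact Or.inl (eq_single_of_le h hq)

theorem eq_zero_of_add_eq_single {q : σ} {e f : σ →₀ ℕ} (hf : f ≠ 0)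
    (h : e + f = Finsupp.single q 1) : e = 0 ∧ f = Finsupp.single q 1 := by
  classical
  have hfq : f q ≠ 0 := by
    obtain ⟨t, ht⟩ := Finsupp.ne_iff.1 hf
    have := DFunLike.congr_fun h t
    by_cases hqt : q = t
    · rwa [hqt]
    · simp [hqt] at this
      exact absurd this.2 ht
  obtain ⟨r, rfl⟩ := exists_add_of_le
    (Finsupp.single_le_iff.2 (Nat.one_le_iff_ne_zero.2 hfq) : Finsupp.single q 1 ≤ f)
  rw [add_left_comm, add_eq_left, add_eq_zero] at h
  rw [h.1, h.2, add_zero]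
  exact ⟨rfl, rfl⟩

theorem add_eq_single_add_single {p q : σ} {e f : σ →₀ ℕ} (he : e ≠ 0) (hf : f ≠ 0)
    (h : e + f = Finsupp.single p 1 + Finsupp.single q 1) :
    (e = Finsupp.single p 1 ∧ f = Finsupp.single q 1) ∨
      (e = Finsupp.single q 1 ∧ f = Finsupp.single p 1) := by
  classical
  obtain ⟨s, hs⟩ := Finsupp.ne_iff.1 he
  obtain ⟨r, rfl⟩ := exists_add_of_le
    (Finsupp.single_le_iff.2 (Nat.one_le_iff_ne_zero.2 hs) : Finsupp.single s 1 ≤ e)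
  by_cases hps : p = s
  · subst hps
    rw [add_assoc, add_right_inj] at h
    obtain ⟨rfl, rfl⟩ := eq_zero_of_add_eq_single hf h
    simp
  by_cases hqs : q = s
  · subst hqs
    rw [add_assoc, add_comm (Finsupp.single p 1), add_right_inj] at h
    obtain ⟨rfl, rfl⟩ := eq_zero_of_add_eq_single hf h
    simp
  have := DFunLike.congr_fun h s
  simp [hps, hqs] at this

variable {g : σ → A} {B : Module.Basis (σ →₀ ℕ) K A} {word : (σ →₀ ℕ) → List σ}

theorem basis_single (hword : ∀ e, expo (word e) = e) (hB : ∀ e, B e = ((word e).map g).prod)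
    (s : σ) : B (Finsupp.single s 1) = g s := by
  have h : (word (Finsupp.single s 1)).Perm [s] := perm_of_expo_eq (by simp [hword])
  rw [hB, List.perm_singleton.1 h]
  simp

theorem basis_zero (hword : ∀ e, expo (word e) = e) (hB : ∀ e, B e = ((word e).map g).prod) :
    B 0 = 1 := by
  have h : (word (0 : σ →₀ ℕ)).Perm [] := perm_of_expo_eq (by simp [hword])
  rw [hB, List.perm_nil.1 h]
  simp

theorem mem_range_algebraMap_of_hasLead_zero {m : MonomialOrder σ}
    (hword : ∀ e, expo (word e) = e) (hB : ∀ e, B e = ((word e).map g).prod)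
    {a : A} (h : HasLead m B a 0) : a ∈ Set.range (algebraMap K A) := by
  classical
  refine ⟨B.repr a 0, B.repr.injective ?_⟩
  rw [Algebra.algebraMap_eq_smul_one, ← basis_zero hword hB]
  ext f
  by_cases hf : f = 0
  · simp [hf]
  · have : B.repr a f = 0 := by
      by_contra h'
      have := h.2 f h'
      rw [map_zero, ← m.eq_zero_iff, m.toSyn_eq_zero_iff] at this
      exact hf this
    simp [Ne.symm hf, this]

/-- The span of the basis monomials with equal exponents of `p` and `q`. -/
def balanced (B : Module.Basis (σ →₀ ℕ) K A) (p q : σ) : Submodule K A :=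
  Submodule.span K (B '' {e | e p = e q})

theorem mem_balanced_iff {p q : σ} {a : A} :
    a ∈ balanced B p q ↔ ∀ e, B.repr a e ≠ 0 → e p = e q := by
  rw [balanced, Module.Basis.mem_span_image]
  simp [Set.subset_def]

/-- Being led by the second letter leaves only remainders free of `p` and `q`: `m₂` gives this for
`a`, and `m₁` for `b`. Comparing leading terms in the balanced part of `ab` then removes `b₀` first
and `a₀` next. -/
theorem eq_smul_of_hasLead {m₁ m₂ : MonomialOrder σ} (hg : ∀ s t, SkewCommute K g m₁ s t)
    (hword : ∀ e, expo (word e) = e) (hB : ∀ e, B e = ((word e).map g).prod)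
    {p q : σ} (hpq : p ≠ q) (h₁ : IsTop m₁ p q) (h₂ : IsTop m₂ q p) {a b : A}
    (ha₁ : HasLead m₁ B a (Finsupp.single p 1)) (ha₂ : HasLead m₂ B a (Finsupp.single p 1))
    (hb : HasLead m₁ B b (Finsupp.single q 1)) (hab : a * b ∈ balanced B p q)
    (hgg : g p * g q ∈ balanced B p q) :
    ∃ c d : Kˣ, a = (c : K) • g p ∧ b = (d : K) • g q := by
  classical
  have hBp := basis_single hword hB p
  have hBq := basis_single hword hB q
  have hp := hasLead_basis m₁ B (Finsupp.single p 1)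
  have hq := hasLead_basis m₁ B (Finsupp.single q 1)
  rw [hBp] at hp
  rw [hBq] at hq
  obtain ⟨α, hα⟩ : ∃ α, α = B.repr a (Finsupp.single p 1) := ⟨_, rfl⟩
  obtain ⟨β, hβ⟩ : ∃ β, β = B.repr b (Finsupp.single q 1) := ⟨_, rfl⟩
  obtain ⟨a₀, ha₀⟩ : ∃ a₀, a₀ = a - α • g p := ⟨_, rfl⟩
  obtain ⟨b₀, hb₀⟩ : ∃ b₀, b₀ = b - β • g q := ⟨_, rfl⟩
  have hα0 : α ≠ 0 := hα ▸ ha₁.1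
  have hβ0 : β ≠ 0 := hβ ▸ hb.1
  have hsa : ∀ e, B.repr a₀ e ≠ 0 → e p = 0 ∧ e q = 0 := by
    intro e he
    rw [ha₀, ← hBp] at he
    by_cases hep : e = Finsupp.single p 1
    · subst hep
      simp [hα] at he
    · have : B.repr a e ≠ 0 := by simpa [Finsupp.single_apply, Ne.symm hep] using he
      rcases h₂.of_le_snd hpq.symm (ha₂.2 e this) with h | h
      · exact absurd h hep
      · exact h.symm
  have hsb : ∀ e, B.repr b₀ e ≠ 0 → e p = 0 ∧ e q = 0 := by
    intro e he
    rw [hb₀, ← hBq] at he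
    by_cases heq : e = Finsupp.single q 1
    · subst heq
      simp [hβ] at he
    · have : B.repr b e ≠ 0 := by simpa [Finsupp.single_apply, Ne.symm heq] using he
      rcases h₁.of_le_snd hpq (hb.2 e this) with h | h
      · exact absurd h heq
      · exact h
  -- This is `ab` minus its main term `αβ • g p * g q`, and both are balanced.
  have hu : α • (g p * b₀) + a₀ * b ∈ balanced B p q := by
    have := sub_mem hab (Submodule.smul_mem _ (α * β) hgg)
    convert this using 1
    rw [ha₀, hb₀]
    simp only [sub_mul, mul_sub, smul_mul_assoc, mul_smul_comm]
    module
  have hlow : ∀ e, HasLead m₁ B a₀ e → HasLead m₁ B (a₀ * b) (e + Finsupp.single q 1) :=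
    fun e he => he.mul hg hword hB hb
  have hb₀0 : b₀ = 0 := by
    by_contra hne
    obtain ⟨f, hf⟩ := exists_hasLead m₁ B hne
    have hfpq := hsb f hf.1
    have hlead := (hp.mul hg hword hB hf).smul hα0
    -- The lead of `a₀ * b` has no `p`, so it cannot cancel that of `g p * b₀`, whose exponents of
    -- `p` and `q` are 1 and 0.
    have : HasLead m₁ B (α • (g p * b₀) + a₀ * b) (Finsupp.single p 1 + f) := by
      by_cases ha₀0 : a₀ = 0
      · simpa [ha₀0] using hlead
      · obtain ⟨e, he⟩ := exists_hasLead m₁ B ha₀0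
        refine hlead.add (hlow e he) (h₁.1 _ _ ?_)
        simp [hsa e he.1, hpq.symm]
    have := mem_balanced_iff.1 hu _ this.1
    simp [hfpq, hpq] at this
  have ha₀0 : a₀ = 0 := by
    by_contra hne
    obtain ⟨e, he⟩ := exists_hasLead m₁ B hne
    rw [hb₀0, mul_zero, smul_zero, zero_add] at hu
    have := mem_balanced_iff.1 hu _ (hlow e he).1
    simp [hsa e he.1, hpq.symm] at this
  exact ⟨Units.mk0 α hα0, Units.mk0 β hβ0, sub_eq_zero.1 (ha₀ ▸ ha₀0), sub_eq_zero.1 (hb₀ ▸ hb₀0)⟩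

theorem HasLead.of_mul_eq_single_add_single {m : MonomialOrder σ}
    (hg : ∀ s t, SkewCommute K g m s t)
    (hword : ∀ e, expo (word e) = e) (hB : ∀ e, B e = ((word e).map g).prod) {p q : σ} {a b : A}
    (ha : a ∉ Set.range (algebraMap K A)) (hb : b ∉ Set.range (algebraMap K A))
    (h : HasLead m B (a * b) (Finsupp.single p 1 + Finsupp.single q 1)) :
    (HasLead m B a (Finsupp.single p 1) ∧ HasLead m B b (Finsupp.single q 1)) ∨
      (HasLead m B a (Finsupp.single q 1) ∧ HasLead m B b (Finsupp.single p 1)) := by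
  obtain ⟨e, he⟩ := exists_hasLead m B (left_ne_zero_of_mul h.ne_zero)
  obtain ⟨f, hf⟩ := exists_hasLead m B (right_ne_zero_of_mul h.ne_zero)
  have he0 : e ≠ 0 := by
    rintro rfl
    exact ha (mem_range_algebraMap_of_hasLead_zero hword hB he)
  have hf0 : f ≠ 0 := by
    rintro rfl
    exact hb (mem_range_algebraMap_of_hasLead_zero hword hB hf)
  rcases add_eq_single_add_single he0 hf0 ((he.mul hg hword hB hf).unique h) with
    ⟨rfl, rfl⟩ | ⟨rfl, rfl⟩
  · exact Or.inl ⟨he, hf⟩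
  · exact Or.inr ⟨he, hf⟩

theorem eq_smul_or_eq_smul_of_hasLead_mul {m₁ m₂ : MonomialOrder σ}
    (hg₁ : ∀ s t, SkewCommute K g m₁ s t) (hg₂ : ∀ s t, SkewCommute K g m₂ s t)
    (hword : ∀ e, expo (word e) = e) (hB : ∀ e, B e = ((word e).map g).prod)
    {p q : σ} (hpq : p ≠ q) (h₁ : IsTop m₁ p q) (h₂ : IsTop m₂ q p) {a b : A}
    (ha : a ∉ Set.range (algebraMap K A)) (hb : b ∉ Set.range (algebraMap K A))
    (hab₁ : HasLead m₁ B (a * b) (Finsupp.single p 1 + Finsupp.single q 1))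
    (hab₂ : HasLead m₂ B (a * b) (Finsupp.single p 1 + Finsupp.single q 1))
    (hab : a * b ∈ balanced B p q) (hpq' : g p * g q ∈ balanced B p q)
    (hqp' : g q * g p ∈ balanced B p q) :
    (∃ c d : Kˣ, a = (c : K) • g p ∧ b = (d : K) • g q) ∨
      ∃ c d : Kˣ, a = (c : K) • g q ∧ b = (d : K) • g p := by
  classical
  have hcomm : balanced B q p = balanced B p q := by
    simp only [balanced, eq_comm]
  -- The two orders cannot disagree on the arrangement: an element led by `q` in `m₁` contains no
  -- monomial with `p`.
  have hsep : ∀ u : A, HasLead m₁ B u (Finsupp.single q 1) →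
      ¬ HasLead m₂ B u (Finsupp.single p 1) := by
    intro u hu hu'
    rcases h₁.of_le_snd hpq (hu.2 _ hu'.1) with h | h
    · exact hpq (Finsupp.single_left_injective one_ne_zero h)
    · simp at h
  rcases hab₁.of_mul_eq_single_add_single hg₁ hword hB ha hb with ⟨h₃, h₄⟩ | ⟨h₃, h₄⟩ <;>
    rcases hab₂.of_mul_eq_single_add_single hg₂ hword hB ha hb with ⟨h₅, h₆⟩ | ⟨h₅, h₆⟩
  · exact Or.inl (eq_smul_of_hasLead hg₁ hword hB hpq h₁ h₂ h₃ h₅ h₄ hab hpq')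
  · exact absurd h₆ (hsep _ h₄)
  · exact absurd h₅ (hsep _ h₃)
  · refine Or.inr (eq_smul_of_hasLead hg₂ hword hB hpq.symm h₂ h₁ h₅ h₃ h₆ ?_ ?_) <;>
      rwa [hcomm]

end Factor

/-! ### The action on polynomials in the `y_j`. -/

section Representation

variable {K : Type*} [Field K] {n : ℕ}

/-- The operator sending the monomial of exponent `γ` to `u γ` times that of exponent `s γ`. -/
noncomputable def wshift (s : (Fin n → ℕ) → Fin n → ℕ) (u : (Fin n → ℕ) → K) :
    Module.End K ((Fin n → ℕ) →₀ K) :=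
  Finsupp.linearCombination K fun γ => Finsupp.single (s γ) (u γ)

theorem wshift_single (s : (Fin n → ℕ) → Fin n → ℕ) (u : (Fin n → ℕ) → K) (γ : Fin n → ℕ)
    (c : K) : wshift s u (Finsupp.single γ c) = Finsupp.single (s γ) (c * u γ) := by
  simp [wshift]

theorem end_ext {S T : Module.End K ((Fin n → ℕ) →₀ K)}
    (h : ∀ γ, S (Finsupp.single γ 1) = T (Finsupp.single γ 1)) : S = T := by
  refine Finsupp.lhom_ext fun γ c => ?_
  rw [← mul_one c, ← smul_eq_mul, ← Finsupp.smul_single, map_smul, map_smul, h]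

/-- The product of the `c k ^ γ k` over `k < j`. -/
def lowerProd (c : Fin n → K) (j : Fin n) (γ : Fin n → ℕ) : K := ∏ k ∈ Finset.Iio j, c k ^ γ k

theorem lowerProd_add_single_of_lt (c : Fin n → K) {i j : Fin n} (h : i < j) (γ : Fin n → ℕ) :
    lowerProd c j (γ + Pi.single i 1) = c i * lowerProd c j γ := by
  simp only [lowerProd, Pi.add_apply, pow_add, Finset.prod_mul_distrib]
  rw [mul_comm, Finset.prod_eq_single i]
  · simp
  · intro k _ hk
    simp [hk]
  · simp [h]

theorem lowerProd_add_single_of_le (c : Fin n → K) {i j : Fin n} (h : j ≤ i) (γ : Fin n → ℕ) :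
    lowerProd c j (γ + Pi.single i 1) = lowerProd c j γ := by
  refine Finset.prod_congr rfl fun k hk => ?_
  have : k ≠ i := ((Finset.mem_Iio.1 hk).trans_le h).ne
  simp [this]

theorem lowerProd_mul (c d : Fin n → K) (j : Fin n) (γ : Fin n → ℕ) :
    lowerProd (fun k => c k * d k) j γ = lowerProd c j γ * lowerProd d j γ := by
  simp [lowerProd, mul_pow, Finset.prod_mul_distrib]

theorem lowerProd_ne_zero {c : Fin n → K} (hc : ∀ k, c k ≠ 0) (j : Fin n) (γ : Fin n → ℕ) :
    lowerProd c j γ ≠ 0 :=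
  Finset.prod_ne_zero_iff.2 fun k _ => pow_ne_zero _ (hc k)

/-- The quantum integer `1 + q + ⋯ + q ^ (m - 1)`. -/
def qnum (q : K) (m : ℕ) : K := ∑ i ∈ Finset.range m, q ^ i

@[simp] theorem qnum_zero (q : K) : qnum q 0 = 0 := by simp [qnum]

theorem qnum_succ (q : K) (m : ℕ) : qnum q (m + 1) = q * qnum q m + 1 := by
  simp only [qnum, Finset.sum_range_succ', pow_succ', Finset.mul_sum, pow_zero]

theorem sub_one_mul_qnum (q : K) (m : ℕ) : (q - 1) * qnum q m = q ^ m - 1 :=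
  mul_geom_sum q m

theorem qnum_ne_zero {q : K} (hq : ∀ k : ℕ, 0 < k → q ^ k ≠ 1) {m : ℕ} (hm : 0 < m) :
    qnum q m ≠ 0 := by
  intro h
  have := sub_one_mul_qnum q m
  rw [h, mul_zero] at this
  exact hq m hm (sub_eq_zero.1 this.symm)

variable (Q : Fin n → Kˣ) (Γ : Matrix (Fin n) (Fin n) Kˣ)

/-- The coefficient in the action of `y_j` on monomials. -/
def yCoeff (j : Fin n) (γ : Fin n → ℕ) : K := lowerProd (fun k => (Γ j k : K)) j γ

/-- The coefficient in the action of `x_j` on monomials. -/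
def xCoeff (j : Fin n) (γ : Fin n → ℕ) : K :=
  lowerProd (fun k => (Q k : K) * (Γ k j : K)) j γ * qnum (Q j : K) (γ j)

/-- The action of the generators on polynomials in the `y_j`. -/
noncomputable def genAction : Gen n → Module.End K ((Fin n → ℕ) →₀ K)
  | Gen.x j => wshift (fun γ => γ - Pi.single j 1) (xCoeff Q Γ j)
  | Gen.y j => wshift (fun γ => γ + Pi.single j 1) (yCoeff Γ j)

theorem genAction_y (j : Fin n) (γ : Fin n → ℕ) (c : K) :
    genAction Q Γ (Gen.y j) (Finsupp.single γ c) =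
      Finsupp.single (γ + Pi.single j 1) (c * yCoeff Γ j γ) :=
  wshift_single _ _ _ _

theorem genAction_x (j : Fin n) (γ : Fin n → ℕ) (c : K) :
    genAction Q Γ (Gen.x j) (Finsupp.single γ c) =
      Finsupp.single (γ - Pi.single j 1) (c * xCoeff Q Γ j γ) :=
  wshift_single _ _ _ _

theorem genAction_x_add (j : Fin n) (γ : Fin n → ℕ) (c : K) :
    genAction Q Γ (Gen.x j) (Finsupp.single (γ + Pi.single j 1) c) =
      Finsupp.single γ (c * xCoeff Q Γ j (γ + Pi.single j 1)) := by
  rw [genAction_x, add_tsub_cancel_right]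

/-- The quantum integer of 0 vanishes, so truncated subtraction of exponents does no harm. -/
theorem genAction_x_of_eq_zero {j : Fin n} {γ : Fin n → ℕ} (h : γ j = 0) (c : K) :
    genAction Q Γ (Gen.x j) (Finsupp.single γ c) = 0 := by
  rw [genAction_x, xCoeff, h]
  simp

theorem exists_eq_add_single {j : Fin n} {γ : Fin n → ℕ} (h : γ j ≠ 0) :
    ∃ δ : Fin n → ℕ, γ = δ + Pi.single j 1 := by
  obtain ⟨δ, hδ⟩ := exists_add_of_le (show (Pi.single j 1 : Fin n → ℕ) ≤ γ by
    intro k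
    by_cases hk : k = j
    · subst hk
      simpa using Nat.one_le_iff_ne_zero.2 h
    · simp [hk])
  exact ⟨δ, by rw [hδ, add_comm]⟩

theorem yCoeff_add_of_lt {i j : Fin n} (h : i < j) (γ : Fin n → ℕ) :
    yCoeff Γ j (γ + Pi.single i 1) = (Γ j i : K) * yCoeff Γ j γ :=
  lowerProd_add_single_of_lt _ h γ

theorem yCoeff_add_of_le {i j : Fin n} (h : j ≤ i) (γ : Fin n → ℕ) :
    yCoeff Γ j (γ + Pi.single i 1) = yCoeff Γ j γ :=
  lowerProd_add_single_of_le _ h γ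

theorem xCoeff_add_of_lt {i j : Fin n} (h : i < j) (γ : Fin n → ℕ) :
    xCoeff Q Γ j (γ + Pi.single i 1) = (Q i : K) * (Γ i j : K) * xCoeff Q Γ j γ := by
  rw [xCoeff, lowerProd_add_single_of_lt _ h, xCoeff]
  simp [h.ne', mul_assoc]

theorem xCoeff_add_of_gt {i j : Fin n} (h : j < i) (γ : Fin n → ℕ) :
    xCoeff Q Γ j (γ + Pi.single i 1) = xCoeff Q Γ j γ := by
  rw [xCoeff, lowerProd_add_single_of_le _ h.le, xCoeff]
  simp [h.ne]

variable {Γ}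

theorem IsMulSkewSymm.mul_eq_one (hΓ : IsMulSkewSymm Γ) (i j : Fin n) :
    (Γ i j : K) * (Γ j i : K) = 1 := by
  rw [← Units.val_mul, hΓ.2, Units.val_one]

/-- Skew-symmetry cancels the entries of `Γ`; hence `y_j x_j` and `x_j y_j` act diagonally with
eigenvalues depending only on `Q`. -/
theorem yCoeff_mul_xCoeff (hΓ : IsMulSkewSymm Γ) (j : Fin n) (γ δ : Fin n → ℕ)
    (h : ∀ k < j, γ k = δ k) :
    yCoeff Γ j γ * xCoeff Q Γ j δ = lowerProd (fun k => (Q k : K)) j δ * qnum (Q j : K) (δ j) := by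
  have h1 : yCoeff Γ j γ = yCoeff Γ j δ :=
    Finset.prod_congr rfl fun k hk => by rw [h k (Finset.mem_Iio.1 hk)]
  rw [h1, yCoeff, xCoeff, ← mul_assoc, ← lowerProd_mul]
  congr 2
  ext k
  rw [mul_left_comm, hΓ.mul_eq_one, mul_one]

theorem genAction_y_mul_x (hΓ : IsMulSkewSymm Γ) (j : Fin n) (γ : Fin n → ℕ) :
    genAction Q Γ (Gen.y j) (genAction Q Γ (Gen.x j) (Finsupp.single γ 1)) =
      Finsupp.single γ (lowerProd (fun k => (Q k : K)) j γ * qnum (Q j : K) (γ j)) := by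
  by_cases h : γ j = 0
  · rw [genAction_x_of_eq_zero Q Γ h, h]
    simp
  · obtain ⟨δ, rfl⟩ := exists_eq_add_single h
    rw [genAction_x_add, genAction_y, ← yCoeff_mul_xCoeff Q hΓ j δ, one_mul, mul_comm]
    intro k hk
    simp [hk.ne]

theorem genAction_x_mul_y (hΓ : IsMulSkewSymm Γ) (j : Fin n) (γ : Fin n → ℕ) :
    genAction Q Γ (Gen.x j) (genAction Q Γ (Gen.y j) (Finsupp.single γ 1)) =
      Finsupp.single γ (lowerProd (fun k => (Q k : K)) j γ * qnum (Q j : K) (γ j + 1)) := by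
  rw [genAction_y, genAction_x_add, one_mul, yCoeff_mul_xCoeff Q hΓ,
    lowerProd_add_single_of_le _ le_rfl]
  · simp
  · intro k hk
    simp [hk.ne]

/-- Since `(q - 1)` times the quantum integer of `m` is `q ^ m - 1`, the sum telescopes. This is the
eigenvalue of the right-hand side of the relation for `x_j y_j`. -/
theorem one_add_sum_lowerProd (j : Fin n) (γ : Fin n → ℕ) :
    1 + ∑ k ∈ Finset.Iio j, ((Q k : K) - 1) *
      (lowerProd (fun k => (Q k : K)) k γ * qnum (Q k : K) (γ k)) =
      lowerProd (fun k => (Q k : K)) j γ := by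
  have := Finset.prod_one_add_ordered (Finset.Iio j) fun k => (Q k : K) ^ γ k - 1
  simp only [add_sub_cancel] at this
  rw [lowerProd, this]
  congr 1
  refine Finset.sum_congr rfl fun k hk => ?_
  rw [mul_left_comm, sub_one_mul_qnum, mul_comm]
  congr 1
  refine Finset.prod_congr ?_ fun _ _ => rfl
  ext l
  simp only [Finset.mem_Iio, Finset.mem_filter] at hk ⊢
  exact ⟨fun h => ⟨h.trans hk, h⟩, fun h => h.2⟩

theorem genAction_rel (hΓ : IsMulSkewSymm Γ) {r s : FreeAlgebra K (Gen n)} (h : Rel Q Γ r s) :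
    FreeAlgebra.lift K (genAction Q Γ) r = FreeAlgebra.lift K (genAction Q Γ) s := by
  induction h with
  | yy i j =>
    simp only [map_mul, map_smul, FreeAlgebra.lift_ι_apply]
    refine end_ext fun γ => ?_
    simp only [Module.End.mul_apply, LinearMap.smul_apply, genAction_y, Finsupp.smul_single,
      smul_eq_mul, one_mul]
    rw [add_right_comm]
    congr 1
    rcases lt_trichotomy i j with h | rfl | h
    · rw [yCoeff_add_of_le Γ h.le, yCoeff_add_of_lt Γ h]
      linear_combination (-yCoeff Γ i γ * yCoeff Γ j γ) * hΓ.mul_eq_one i j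
    · rw [hΓ.1]
      simp
    · rw [yCoeff_add_of_le Γ h.le, yCoeff_add_of_lt Γ h]
      ring
  | xx i j h =>
    simp only [map_mul, map_smul, FreeAlgebra.lift_ι_apply]
    refine end_ext fun γ => ?_
    simp only [Module.End.mul_apply, LinearMap.smul_apply]
    by_cases hi : γ i = 0
    · rw [genAction_x_of_eq_zero Q Γ hi, genAction_x, genAction_x_of_eq_zero Q Γ (by simp [hi])]
      simp
    by_cases hj : γ j = 0
    · rw [genAction_x_of_eq_zero Q Γ hj, genAction_x, genAction_x_of_eq_zero Q Γ (by simp [hj])]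
      simp
    obtain ⟨δ, rfl⟩ := exists_eq_add_single hi
    obtain ⟨ε, rfl⟩ := exists_eq_add_single (j := j) (γ := δ) (by simpa [h.ne'] using hj)
    rw [genAction_x_add, add_right_comm, genAction_x_add, genAction_x_add, genAction_x_add,
      Finsupp.smul_single]
    congr 1
    rw [add_right_comm, xCoeff_add_of_lt Q Γ h, add_right_comm ε, xCoeff_add_of_gt Q Γ h,
      smul_eq_mul]
    ring
  | xy_lt i j h =>
    simp only [map_mul, map_smul, FreeAlgebra.lift_ι_apply]
    refine end_ext fun γ => ?_
    simp only [Module.End.mul_apply, LinearMap.smul_apply]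
    by_cases hi : γ i = 0
    · rw [genAction_x_of_eq_zero Q Γ hi, genAction_y,
        genAction_x_of_eq_zero Q Γ (by simp [hi, h.ne])]
      simp
    obtain ⟨δ, rfl⟩ := exists_eq_add_single hi
    rw [genAction_x_add, genAction_y, add_right_comm, genAction_x_add, genAction_y,
      Finsupp.smul_single]
    congr 1
    rw [add_right_comm, xCoeff_add_of_gt Q Γ h, yCoeff_add_of_lt Γ h, smul_eq_mul]
    ring
  | xy_gt i j h =>
    simp only [map_mul, map_smul, FreeAlgebra.lift_ι_apply]
    refine end_ext fun γ => ?_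
    simp only [Module.End.mul_apply, LinearMap.smul_apply]
    by_cases hi : γ i = 0
    · rw [genAction_x_of_eq_zero Q Γ hi, genAction_y,
        genAction_x_of_eq_zero Q Γ (by simp [hi, h.ne'])]
      simp
    obtain ⟨δ, rfl⟩ := exists_eq_add_single hi
    rw [genAction_x_add, genAction_y, add_right_comm, genAction_x_add, genAction_y,
      Finsupp.smul_single]
    congr 1
    rw [add_right_comm, xCoeff_add_of_lt Q Γ h, yCoeff_add_of_le Γ h.le, smul_eq_mul]
    ring
  | xy_eq j =>
    simp only [map_sub, map_add, map_one, map_sum, map_mul, map_smul, FreeAlgebra.lift_ι_apply]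
    refine end_ext fun γ => ?_
    simp only [Module.End.mul_apply, LinearMap.smul_apply, LinearMap.sub_apply,
      LinearMap.add_apply, LinearMap.sum_apply, Module.End.one_apply, genAction_y_mul_x Q hΓ,
      genAction_x_mul_y Q hΓ, Finsupp.smul_single, smul_eq_mul]
    rw [← Finsupp.single_sub, ← Finsupp.single_finsetSum, ← Finsupp.single_add,
      one_add_sum_lowerProd, qnum_succ]
    congr 1
    ring

/-- The representation of the quantized Weyl algebra on polynomials in the `y_j`. -/
noncomputable def action (hΓ : IsMulSkewSymm Γ) :
    QWeyl Q Γ →ₐ[K] Module.End K ((Fin n → ℕ) →₀ K) :=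
  RingQuot.liftAlgHom K ⟨FreeAlgebra.lift K (genAction Q Γ), fun _ _ h => genAction_rel Q hΓ h⟩

theorem action_gen (hΓ : IsMulSkewSymm Γ) (g : Gen n) :
    action Q hΓ (gen Q Γ g) = genAction Q Γ g := by
  refine (RingQuot.liftAlgHom_mkAlgHom_apply K _ _ _).trans ?_
  exact FreeAlgebra.lift_ι_apply _ _

theorem action_prod_y (hΓ : IsMulSkewSymm Γ) (l : List (Fin n)) (γ : Fin n → ℕ) :
    ∃ c : K, c ≠ 0 ∧ action Q hΓ ((l.map fun i => gen Q Γ (Gen.y i)).prod) (Finsupp.single γ 1) =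
      Finsupp.single (γ + fun i => l.count i) c := by
  induction l with
  | nil => exact ⟨1, one_ne_zero, by simp [show (fun _ : Fin n => 0) = 0 from rfl]⟩
  | cons j l ih =>
    obtain ⟨c, hc, h⟩ := ih
    refine ⟨_, mul_ne_zero hc (lowerProd_ne_zero (c := fun k => (Γ j k : K)) (fun k => by simp) j
      (γ + fun i => l.count i)), ?_⟩
    rw [List.map_cons, List.prod_cons, map_mul, Module.End.mul_apply, h, action_gen, genAction_y]
    rw [show (γ + fun i => l.count i) + Pi.single j 1 = γ + fun i => (j :: l).count i from ?_]
    · rfl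
    · ext i
      by_cases hi : i = j
      · subst hi
        simp [add_assoc]
      · simp [hi, List.count_cons, Ne.symm hi]

/-- The scalar is a product of units and quantum integers. It vanishes once an exponent is exhausted
and, without roots of unity, only then. -/
theorem action_prod_x (hΓ : IsMulSkewSymm Γ) (l : List (Fin n)) (γ : Fin n → ℕ) :
    ∃ c : K, action Q hΓ ((l.map fun i => gen Q Γ (Gen.x i)).prod) (Finsupp.single γ 1) =
      Finsupp.single (γ - fun i => l.count i) c ∧ (c ≠ 0 → ∀ i, l.count i ≤ γ i) ∧
      ((∀ i k, 0 < k → Q i ^ k ≠ 1) → (∀ i, l.count i ≤ γ i) → c ≠ 0) := by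
  induction l with
  | nil => exact ⟨1, by simp [show (fun _ : Fin n => 0) = 0 from rfl], by simp, by simp⟩
  | cons j l ih =>
    obtain ⟨c, h, h₁, h₂⟩ := ih
    refine ⟨c * xCoeff Q Γ j (γ - fun i => l.count i), ?_, ?_, ?_⟩
    · rw [List.map_cons, List.prod_cons, map_mul, Module.End.mul_apply, h, action_gen, genAction_x]
      congr 1
      ext i
      by_cases hi : i = j
      · subst hi
        simp [Nat.sub_sub]
      · simp [hi, List.count_cons, Ne.symm hi]
    · intro hc i
      have h₃ := h₁ (left_ne_zero_of_mul hc) i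
      by_cases hi : i = j
      · subst hi
        have := right_ne_zero_of_mul (right_ne_zero_of_mul hc)
        have h₄ : γ i - l.count i ≠ 0 := fun h₄ => this (by simp [h₄])
        rw [List.count_cons_self]
        omega
      · simpa [List.count_cons, Ne.symm hi] using h₃
    · intro hQ hle
      have hle' : ∀ i, l.count i ≤ γ i := fun i => le_trans (List.count_le_count_cons) (hle i)
      refine mul_ne_zero (h₂ hQ hle') (mul_ne_zero (lowerProd_ne_zero (fun k => by simp) _ _) ?_)
      refine qnum_ne_zero (fun k hk hk1 => hQ j k hk (Units.ext (by simpa using hk1))) ?_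
      have := hle j
      rw [List.count_cons_self] at this
      simp only [Pi.sub_apply]
      omega

end Representation

/-! ### The basis of normally ordered monomials. -/

section Basis

variable {K : Type*} [Field K] {n : ℕ}

/-- A word in the letters `Fin n` with the given exponents. -/
noncomputable def indexWord (c : Fin n → ℕ) : List (Fin n) :=
  (Finsupp.toMultiset (Finsupp.equivFunOnFinite.symm c)).toList

theorem count_indexWord (c : Fin n → ℕ) (i : Fin n) : (indexWord c).count i = c i := by
  rw [indexWord, ← Multiset.coe_count, Multiset.coe_toList, Finsupp.count_toMultiset]
  rfl

/-- The normally ordered word with a given exponent: the `y`'s precede the `x`'s. -/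
noncomputable def normalWord (e : Gen n →₀ ℕ) : List (Gen n) :=
  (indexWord fun i => e (Gen.y i)).map Gen.y ++ (indexWord fun i => e (Gen.x i)).map Gen.x

theorem Gen.x_injective : Function.Injective (Gen.x : Fin n → Gen n) := fun _ _ h => by
  cases h; rfl

theorem Gen.y_injective : Function.Injective (Gen.y : Fin n → Gen n) := fun _ _ h => by
  cases h; rfl

theorem expo_normalWord (e : Gen n →₀ ℕ) : expo (normalWord e) = e := by
  classical
  ext s
  rw [expo_apply, normalWord, List.count_append]
  cases s with
  | x i =>
    rw [List.count_map_of_injective _ _ Gen.x_injective, count_indexWord,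
      List.count_eq_zero_of_not_mem (by simp), zero_add]
  | y i =>
    rw [List.count_map_of_injective _ _ Gen.y_injective, count_indexWord,
      List.count_eq_zero_of_not_mem (l := List.map Gen.x _) (by simp), add_zero]

variable (Q : Fin n → Kˣ) {Γ : Matrix (Fin n) (Fin n) Kˣ}

theorem action_normalWord (hΓ : IsMulSkewSymm Γ) (e : Gen n →₀ ℕ) (γ : Fin n → ℕ) :
    ∃ c : K, action Q hΓ (((normalWord e).map (gen Q Γ)).prod) (Finsupp.single γ 1) =
      Finsupp.single ((γ - fun i => e (Gen.x i)) + fun i => e (Gen.y i)) c ∧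
      (c ≠ 0 → ∀ i, e (Gen.x i) ≤ γ i) ∧
      ((∀ i k, 0 < k → Q i ^ k ≠ 1) → (∀ i, e (Gen.x i) ≤ γ i) → c ≠ 0) := by
  obtain ⟨c, h, h₁, h₂⟩ := action_prod_x Q hΓ (indexWord fun i => e (Gen.x i)) γ
  obtain ⟨d, hd, h₃⟩ := action_prod_y Q hΓ (indexWord fun i => e (Gen.y i))
    (γ - fun i => e (Gen.x i))
  simp only [count_indexWord] at h h₁ h₂ h₃
  refine ⟨c * d, ?_, fun hc => h₁ (left_ne_zero_of_mul hc), fun hQ hle =>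
    mul_ne_zero (h₂ hQ hle) hd⟩
  rw [normalWord, List.map_append, List.prod_append, map_mul, Module.End.mul_apply, List.map_map,
    List.map_map]
  erw [h]
  rw [← mul_one c, ← smul_eq_mul, ← Finsupp.smul_single, map_smul]
  erw [h₃]
  simp

/-- Evaluating a relation on one well-chosen monomial and reading off one coefficient isolates a
single term. -/
theorem linearIndependent_normalWord (hΓ : IsMulSkewSymm Γ)
    (hQ : ∀ i k, 0 < k → Q i ^ k ≠ 1) :
    LinearIndependent K fun e => ((normalWord e).map (gen Q Γ)).prod := by
  rw [linearIndependent_iff]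
  intro l hl
  by_contra hne
  -- Minimal total `x`-degree: on the monomial with exponents `e₀ (Gen.x i)`, a surviving term has
  -- `x`-part at most that of `e₀`, hence equal to it. Its `y`-part then appears as the resulting
  -- exponent.
  obtain ⟨e₀, he₀, hmin⟩ := l.support.exists_min_image (fun e => ∑ i, e (Gen.x i))
    (Finsupp.support_nonempty_iff.2 hne)
  have h := congr_arg (fun a => action Q hΓ a (Finsupp.single (fun i => e₀ (Gen.x i)) 1)
    (fun i => e₀ (Gen.y i))) hl
  simp only [Finsupp.linearCombination_apply, Finsupp.sum, map_sum, map_smul, LinearMap.sum_apply,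
    LinearMap.smul_apply, map_zero, LinearMap.zero_apply, Finsupp.coe_zero, Pi.zero_apply,
    Finsupp.finsetSum_apply, Finsupp.smul_apply] at h
  rw [Finset.sum_eq_single e₀] at h
  · obtain ⟨c, hc, -, h₂⟩ := action_normalWord Q hΓ e₀ fun i => e₀ (Gen.x i)
    rw [hc, tsub_self, zero_add, Finsupp.single_eq_same, smul_eq_mul] at h
    exact mul_ne_zero (Finsupp.mem_support_iff.1 he₀) (h₂ hQ fun _ => le_rfl) h
  · intro e he hee
    obtain ⟨c, hc, h₁, -⟩ := action_normalWord Q hΓ e fun i => e₀ (Gen.x i)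
    rw [hc]
    by_cases hc0 : c = 0
    · simp [hc0]
    have hle := h₁ hc0
    have heq : ∀ i, e (Gen.x i) = e₀ (Gen.x i) := fun i =>
      (Finset.sum_eq_sum_iff_of_le fun i _ => hle i).1
        (le_antisymm (Finset.sum_le_sum fun i _ => hle i) (hmin e he)) i (Finset.mem_univ i)
    have hy : (fun i => e (Gen.y i)) ≠ fun i => e₀ (Gen.y i) := by
      intro hy
      apply hee
      ext s
      cases s with
      | x i => exact heq i
      | y i => exact congr_fun hy i
    simp only [heq]
    rw [show ((fun i => e₀ (Gen.x i)) - fun i => e₀ (Gen.x i)) = 0 from tsub_self _, zero_add,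
      Finsupp.single_eq_of_ne hy.symm, smul_zero]
  · intro h
    exact absurd he₀ h

variable (Γ)

theorem span_words_eq_top :
    Submodule.span K (Set.range fun w : List (Gen n) => (w.map (gen Q Γ)).prod) = ⊤ := by
  have hadj : Algebra.adjoin K (Set.range (gen Q Γ)) = ⊤ := by
    have h : Set.range (gen Q Γ) = mk Q Γ '' Set.range (FreeAlgebra.ι K) := by
      rw [← Set.range_comp]
      rfl
    rw [h, ← AlgHom.map_adjoin, FreeAlgebra.adjoin_range_ι, Algebra.map_top,
      AlgHom.range_eq_top]
    exact RingQuot.mkAlgHom_surjective K (Rel Q Γ)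
  rw [eq_top_iff, ← Algebra.top_toSubmodule, ← hadj, Algebra.adjoin_eq_span]
  refine Submodule.span_mono fun a ha => ?_
  obtain ⟨l, hl, rfl⟩ := Submonoid.exists_list_of_mem_closure ha
  clear ha
  induction l with
  | nil => exact ⟨[], rfl⟩
  | cons a l ih =>
    obtain ⟨w, hw⟩ := ih fun b hb => hl b (List.mem_cons_of_mem _ hb)
    obtain ⟨s, rfl⟩ := hl a List.mem_cons_self
    exact ⟨s :: w, by rw [List.prod_cons, ← hw]; simp⟩

theorem mk_rel {r s : FreeAlgebra K (Gen n)} (h : Rel Q Γ r s) : mk Q Γ r = mk Q Γ s :=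
  RingQuot.mkAlgHom_rel K h

theorem x_mul_y_sub (j : Fin n) :
    gen Q Γ (Gen.x j) * gen Q Γ (Gen.y j) -
      (Q j : K) • (gen Q Γ (Gen.y j) * gen Q Γ (Gen.x j)) =
      1 + ∑ k ∈ Finset.Iio j, ((Q k : K) - 1) • (gen Q Γ (Gen.y k) * gen Q Γ (Gen.x k)) := by
  have h := mk_rel Q Γ (Rel.xy_eq j)
  simp only [map_sub, map_add, map_mul, map_smul, map_one, map_sum] at h
  exact h

theorem skewCommute_of_mk_eq {m : MonomialOrder (Gen n)} {s t : Gen n} {c : K} (hc : c ≠ 0)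
    (h : mk Q Γ (FreeAlgebra.ι K s * FreeAlgebra.ι K t) =
      mk Q Γ (c • (FreeAlgebra.ι K t * FreeAlgebra.ι K s))) :
    SkewCommute K (gen Q Γ) m s t := by
  refine ⟨c, hc, ?_⟩
  rw [map_smul, map_mul, map_mul] at h
  change gen Q Γ s * gen Q Γ t = c • (gen Q Γ t * gen Q Γ s) at h
  rw [h, sub_self]
  exact zero_mem _

/-- Only `x_j y_j` has a correction, made of `1` and of `y_k x_k` with `k < j`; `hm` is exactly what
makes the latter lower. -/
theorem skewCommute_gen {m : MonomialOrder (Gen n)}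
    (hm : ∀ k j : Fin n, k < j → Finsupp.single (Gen.y k) 1 + Finsupp.single (Gen.x k) 1 ≺[m]
      Finsupp.single (Gen.y j) 1 + Finsupp.single (Gen.x j) 1) (s t : Gen n) :
    SkewCommute K (gen Q Γ) m s t := by
  have hxx : ∀ i j : Fin n, i < j → SkewCommute K (gen Q Γ) m (Gen.x i) (Gen.x j) := fun i j h =>
    skewCommute_of_mk_eq Q Γ (by simp) (mk_rel Q Γ (Rel.xx i j h))
  have hxy : ∀ i j : Fin n, SkewCommute K (gen Q Γ) m (Gen.x i) (Gen.y j) := by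
    intro i j
    rcases lt_trichotomy i j with h | rfl | h
    · exact skewCommute_of_mk_eq Q Γ (by simp) (mk_rel Q Γ (Rel.xy_lt i j h))
    · refine ⟨Q i, by simp, ?_⟩
      rw [x_mul_y_sub]
      refine add_mem ?_ (sum_mem fun k hk => Submodule.smul_mem _ _ ?_)
      · refine prod_mem_low (w := []) (m.toSyn_strictMono ?_)
        rw [expo_nil]
        exact pos_of_ne_zero (by simp)
      · have := prod_mem_low (K := K) (g := gen Q Γ) (m := m) (w := [Gen.y k, Gen.x k])
          (e := Finsupp.single (Gen.x i) 1 + Finsupp.single (Gen.y i) 1)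
          (by simpa [add_comm] using hm k i (Finset.mem_Iio.1 hk))
        simpa using this
    · exact skewCommute_of_mk_eq Q Γ (by simp) (mk_rel Q Γ (Rel.xy_gt i j h))
  cases s with
  | x i =>
    cases t with
    | x j =>
      rcases lt_trichotomy i j with h | rfl | h
      · exact hxx i j h
      · exact ⟨1, one_ne_zero, by simp⟩
      · exact (hxx j i h).symm
    | y j => exact hxy i j
  | y i =>
    cases t with
    | x j => exact (hxy j i).symm
    | y j => exact skewCommute_of_mk_eq Q Γ (by simp) (mk_rel Q Γ (Rel.yy i j))

variable {Γ}

/-- The normally ordered monomials form a basis. -/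
theorem exists_basis (hΓ : IsMulSkewSymm Γ) (hQ : ∀ i k, 0 < k → Q i ^ k ≠ 1)
    {m : MonomialOrder (Gen n)} (hg : ∀ s t, SkewCommute K (gen Q Γ) m s t) :
    ∃ B : Module.Basis (Gen n →₀ ℕ) K (QWeyl Q Γ),
      ∀ e, B e = ((normalWord e).map (gen Q Γ)).prod := by
  refine ⟨Module.Basis.mk (linearIndependent_normalWord Q hΓ hQ) ?_, fun e => Module.Basis.mk_apply _ _ e⟩
  rw [← span_words_eq_top Q Γ]
  exact span_words_le hg expo_normalWord

end Basis

/-! ### Two lexicographic orders on exponents. -/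

section Order

theorem exists_lex {σ : Type} [Finite σ] {r : σ → ℕ} (hr : Function.Injective r) :
    ∃ m : MonomialOrder.{0, 0} σ, ∀ (s : σ) (e f : σ →₀ ℕ), (∀ t, r t < r s → e t = f t) → e s < f s →
      e ≺[m] f := by
  let _ : LinearOrder σ := LinearOrder.lift' r hr
  refine ⟨MonomialOrder.lex, fun s e f h hs => ?_⟩
  rw [MonomialOrder.lex_lt_iff, Finsupp.Lex.lt_iff]
  exact ⟨s, fun t ht => h t ht, hs⟩

instance {n : ℕ} : Finite (Gen n) := by
  refine Finite.of_surjective (fun s : Fin n ⊕ Fin n => Sum.elim Gen.x Gen.y s) ?_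
  rintro (i | i)
  · exact ⟨Sum.inl i, rfl⟩
  · exact ⟨Sum.inr i, rfl⟩

/-- Reversed position of the generators, `u` and `1 - u` being the offsets of the `x`'s and of
the `y`'s. -/
def Gen.rank {n : ℕ} (u : ℕ) : Gen n → ℕ
  | Gen.x i => 2 * (n - 1 - i) + u
  | Gen.y i => 2 * (n - 1 - i) + (1 - u)

theorem Gen.rank_injective {n u : ℕ} (hu : u ≤ 1) :
    Function.Injective (Gen.rank u : Gen n → ℕ) := by
  rintro (i | i) (j | j) h <;> simp only [Gen.rank] at h <;> have := i.2 <;> have := j.2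
  · rw [Fin.ext (by omega : (i : ℕ) = j)]
  · omega
  · omega
  · rw [Fin.ext (by omega : (i : ℕ) = j)]

theorem exists_monomialOrder {n u : ℕ} (hu : u ≤ 1) :
    ∃ m : MonomialOrder.{0, 0} (Gen n),
      (∀ k j : Fin n, k < j → Finsupp.single (Gen.y k) 1 + Finsupp.single (Gen.x k) 1 ≺[m]
        Finsupp.single (Gen.y j) 1 + Finsupp.single (Gen.x j) 1) ∧
      ∀ p q : Gen n, p.rank u = 0 → q.rank u = 1 → IsTop m p q := by
  classical
  obtain ⟨m, hm⟩ := exists_lex (Gen.rank_injective (n := n) hu)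
  refine ⟨m, fun k j hkj => ?_, fun p q hp hq => ⟨fun e f h => hm p e f ?_ h,
    fun e f h h' => hm q e f ?_ h'⟩⟩
  · obtain ⟨s, hs, hs'⟩ : ∃ s : Gen n, s.rank u = 2 * (n - 1 - j) ∧ (s = Gen.x j ∨ s = Gen.y j) := by
      rcases Nat.le_one_iff_eq_zero_or_eq_one.1 hu with rfl | rfl
      · exact ⟨Gen.x j, by simp [Gen.rank], Or.inl rfl⟩
      · exact ⟨Gen.y j, by simp [Gen.rank], Or.inr rfl⟩
    refine hm s _ _ (fun t ht => ?_) ?_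
    · rw [hs] at ht
      have := j.2
      have h : ∀ i : Fin n, i ≤ j → t ≠ Gen.x i ∧ t ≠ Gen.y i := by
        intro i hi
        constructor <;> rintro rfl <;> simp only [Gen.rank] at ht <;> omega
      simp [(h k hkj.le).1.symm, (h k hkj.le).2.symm, (h j le_rfl).1.symm,
        (h j le_rfl).2.symm]
    · rcases hs' with rfl | rfl <;> simp [hkj.ne]
  · intro t ht
    omega
  · intro t ht
    rw [Gen.rank_injective hu (show t.rank u = p.rank u by omega), h]

end Order

/-! ### The span of `1` and the `y_k x_k`. -/

section Factorization

variable {K : Type*} [Field K] {n : ℕ} (Q : Fin n → Kˣ) (Γ : Matrix (Fin n) (Fin n) Kˣ)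

/-- The exponent of `y_k x_k`. -/
noncomputable def pairExpo (k : Fin n) : Gen n →₀ ℕ :=
  Finsupp.single (Gen.y k) 1 + Finsupp.single (Gen.x k) 1

variable {Q Γ} {B : Module.Basis (Gen n →₀ ℕ) K (QWeyl Q Γ)}

theorem basis_pairExpo (hB : ∀ e, B e = ((normalWord e).map (gen Q Γ)).prod) (k : Fin n) :
    B (pairExpo k) = y Q Γ k * x Q Γ k := by
  classical
  have key : ∀ c : Fin n → ℕ, (∀ i, c i = if i = k then 1 else 0) → indexWord c = [k] := by
    intro c hc
    refine List.perm_singleton.1 (List.perm_iff_count.2 fun i => ?_)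
    rw [count_indexWord, hc]
    simp [List.count_singleton, eq_comm (a := k)]
  rw [hB, normalWord, key _ fun i => ?_, key _ fun i => ?_]
  · simp [x, y]
  · simp [pairExpo, Finsupp.single_apply, eq_comm]
  · simp [pairExpo, Finsupp.single_apply, eq_comm]

/-- The span of the basis monomials `1` and `y_k x_k`. -/
noncomputable def pairSpan (B : Module.Basis (Gen n →₀ ℕ) K (QWeyl Q Γ)) : Submodule K (QWeyl Q Γ) :=
  Submodule.span K (B '' insert 0 (Set.range pairExpo))

theorem y_mul_x_mem_pairSpan (hB : ∀ e, B e = ((normalWord e).map (gen Q Γ)).prod) (k : Fin n) :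
    y Q Γ k * x Q Γ k ∈ pairSpan B :=
  Submodule.subset_span ⟨pairExpo k, Or.inr ⟨k, rfl⟩, basis_pairExpo hB k⟩

theorem z_mem_pairSpan (hB : ∀ e, B e = ((normalWord e).map (gen Q Γ)).prod) (i : Fin n) :
    z Q Γ i ∈ pairSpan B := by
  rw [z_eq]
  exact add_mem (Submodule.subset_span ⟨0, Or.inl rfl, basis_zero expo_normalWord hB⟩)
    (sum_mem fun k _ => Submodule.smul_mem _ _ (y_mul_x_mem_pairSpan hB k))

theorem x_mul_y_mem_pairSpan (hB : ∀ e, B e = ((normalWord e).map (gen Q Γ)).prod) (k : Fin n) :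
    x Q Γ k * y Q Γ k ∈ pairSpan B := by
  have := add_mem (z_mem_pairSpan hB k) (y_mul_x_mem_pairSpan hB k)
  rwa [z, sub_add_cancel] at this

theorem pairSpan_le_balanced (k : Fin n) : pairSpan B ≤ balanced B (Gen.y k) (Gen.x k) := by
  classical
  refine Submodule.span_mono (Set.image_mono ?_)
  rintro _ (rfl | ⟨j, rfl⟩)
  · simp
  · simp [pairExpo, Finsupp.single_apply]

theorem repr_eq_zero_or_of_mem_pairSpan {a : QWeyl Q Γ} (ha : a ∈ pairSpan B) {e : Gen n →₀ ℕ}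
    (he : B.repr a e ≠ 0) : e = 0 ∨ ∃ k, pairExpo k = e :=
  (Module.Basis.mem_span_image B).1 ha (by simpa using he)

/-- Without `y_N x_N`, only `1` and products of generators of weight 0 remain. -/
theorem mem_filtration_zero (hB : ∀ e, B e = ((normalWord e).map (gen Q Γ)).prod)
    {N : Fin n} (hN : ∀ k, k ≤ N) {a : QWeyl Q Γ} (ha : a ∈ pairSpan B)
    (h : B.repr a (pairExpo N) = 0) : a ∈ filtration Q Γ 0 := by
  rw [← B.linearCombination_repr a, Finsupp.linearCombination_apply]
  refine sum_mem fun e he => Submodule.smul_mem _ _ (Submodule.subset_span ?_)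
  have he' := Finsupp.mem_support_iff.1 he
  rcases repr_eq_zero_or_of_mem_pairSpan ha he' with rfl | ⟨k, rfl⟩
  · exact ⟨[], by simp, by simp [basis_zero expo_normalWord hB]⟩
  · have hk : (k : ℕ) + 1 ≠ n := by
      intro hk
      have : k = N := le_antisymm (hN k) (by rw [Fin.le_def]; have := N.2; omega)
      rw [this] at he'
      exact he' h
    exact ⟨[Gen.y k, Gen.x k], by simp [Gen.wt, hk], by simp [basis_pairExpo hB, x, y]⟩

theorem hasLead_of_mem_pairSpan {m : MonomialOrder (Gen n)}
    (hm : ∀ k j : Fin n, k < j → pairExpo k ≺[m] pairExpo j)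
    {N : Fin n} (hN : ∀ k, k ≤ N) {a : QWeyl Q Γ} (ha : a ∈ pairSpan B)
    (h : B.repr a (pairExpo N) ≠ 0) : HasLead m B a (pairExpo N) := by
  refine ⟨h, fun e he => ?_⟩
  rcases repr_eq_zero_or_of_mem_pairSpan ha he with rfl | ⟨k, rfl⟩
  · simp
  · rcases (hN k).lt_or_eq with hk | rfl
    · exact (hm _ _ hk).le
    · exact le_rfl

end Factorization

end MQWA

theorem lemma4p2 {K : Type*} [Field K] (n : ℕ) (hn : 0 < n)
    (Q : Fin n → Kˣ) (Γ : Matrix (Fin n) (Fin n) Kˣ) (hΓ : MQWA.IsMulSkewSymm Γ)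
    (hQ : ∀ i : Fin n, ∀ k : ℕ, 0 < k → Q i ^ k ≠ 1)
    (a b : MQWA.QWeyl Q Γ)
    (ha : a ∉ Set.range (algebraMap K (MQWA.QWeyl Q Γ)))
    (hb : b ∉ Set.range (algebraMap K (MQWA.QWeyl Q Γ)))
    (hd : MQWA.degree Q Γ (a * b) = 2)
    (hspan : a * b ∈ Submodule.span K (Set.range (MQWA.z Q Γ))) :
    (∃ μ ν : Kˣ,
        a = (μ : K) • MQWA.x Q Γ ⟨n - 1, Nat.sub_lt hn Nat.one_pos⟩ ∧
        b = (ν : K) • MQWA.y Q Γ ⟨n - 1, Nat.sub_lt hn Nat.one_pos⟩) ∨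
      (∃ μ ν : Kˣ,
        a = (μ : K) • MQWA.y Q Γ ⟨n - 1, Nat.sub_lt hn Nat.one_pos⟩ ∧
        b = (ν : K) • MQWA.x Q Γ ⟨n - 1, Nat.sub_lt hn Nat.one_pos⟩) := by
  obtain ⟨N, hN⟩ : ∃ N : Fin n, N = ⟨n - 1, Nat.sub_lt hn Nat.one_pos⟩ := ⟨_, rfl⟩
  rw [← hN]
  have hNle : ∀ k, k ≤ N := fun k => by
    rw [hN, Fin.le_def]
    exact Nat.le_sub_one_of_lt k.2
  -- The offset 1 puts `y_N` first and `x_N` second; the offset 0 exchanges them.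
  obtain ⟨m₁, hm₁, ht₁⟩ := MQWA.exists_monomialOrder (n := n) (u := 1) le_rfl
  obtain ⟨m₂, hm₂, ht₂⟩ := MQWA.exists_monomialOrder (n := n) (u := 0) zero_le_one
  have hg₁ := MQWA.skewCommute_gen Q Γ hm₁
  have hg₂ := MQWA.skewCommute_gen Q Γ hm₂
  -- The basis monomials do not depend on the order, so one `B` serves both `m₁` and `m₂`.
  obtain ⟨B, hB⟩ := MQWA.exists_basis Q hΓ hQ hg₁
  have hab : a * b ∈ MQWA.pairSpan B :=
    Submodule.span_le.2 (Set.range_subset_iff.2 fun i => MQWA.z_mem_pairSpan hB i) hspan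
  have hne : B.repr (a * b) (MQWA.pairExpo N) ≠ 0 := by
    intro h
    -- Degree 2 matters only in that it is not 0: it forces `y_N x_N` to occur.
    have h₀ : MQWA.degree Q Γ (a * b) ≤ 0 :=
      Nat.sInf_le (MQWA.mem_filtration_zero hB hNle hab h)
    omega
  have hbal := MQWA.pairSpan_le_balanced (B := B) N
  refine (MQWA.eq_smul_or_eq_smul_of_hasLead_mul hg₁ hg₂ MQWA.expo_normalWord hB
    (by simp : MQWA.Gen.y N ≠ MQWA.Gen.x N) (ht₁ _ _ ?_ ?_) (ht₂ _ _ ?_ ?_) ha hb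
    (MQWA.hasLead_of_mem_pairSpan hm₁ hNle hab hne)
    (MQWA.hasLead_of_mem_pairSpan hm₂ hNle hab hne) (hbal hab)
    (hbal (MQWA.y_mul_x_mem_pairSpan hB N)) (hbal (MQWA.x_mul_y_mem_pairSpan hB N))).symm
  all_goals simp [MQWA.Gen.rank, hN]
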